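/- Let $n$ be a natural number. An operator fractional Brownian motion (OFBM) in $\mathbb R^n$ is a Gaussian process $\{B(t)\}_{t\in\mathbb R}$ with values in $\mathbb R^n$ that - is proper: for each $t\neq 0$ the distribution of $B(t)$ is not contained in a proper subspace of $\mathbb R^n$; - is continuous in law: for each $t$, $B(s)$ converges in law to $B(t)$ as $s\to t$; - has stationary increments: the law of $\{B(t+u)-B(u)\}_{t\in\mathbb R}$ does not depend on $u\in\mathbb R$; - is operator self-similar: for some real $n\times n$ matrix $H$, $\{B(ct)\}_{t\in\mathbb R}\stackrel{\mathcal L}{=}\{c^{H}B(t)\}_{t\in\mathbb R}$ for all $c>0$, where $c^H=\exp(\log(c)H)$ and $\stackrel{\mathcal L}{=}$ denotes equality of all finite-dimensional distributions. Each matrix $H$ with the last property is called an exponent of $B$. The symmetry group $G_1(B)$ is the set of invertible real $n\times n$ matrices $A$ with $\{B(t)\}_{t\in\mathbb R}\stackrel{\mathcal L}{=}\{AB(t)\}_{t\in\mathbb R}$, and $B$ is time-reversible if $\{B(t)\}_{t\in\mathbb R}\stackrel{\mathcal L}{=}\{B(-t)\}_{t\in\mathbb R}$. **Proposition.** Let $B$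 be an OFBM in $\mathbb R^n$ such that $hI$ is an exponent of $B$ for some $h\in(0,1)$. Then $B$ is time-reversible if and only if $G_1(B)$ is conjugate to the orthogonal group $O(n)$, that is, if and only if $G_1(B)=W\,O(n)\,W^{-1}$ for some invertible real $n\times n$ matrix $W$. -/

import Mathlib

open MeasureTheory ProbabilityTheory Filter Topology Matrix

/-! Processes `X : ℝ → Ω → (Fin n → ℝ)` indexed by the whole real line, with values in `ℝⁿ`.
Only the linear, topological and Borel structure of `ℝⁿ` is used below (no norm). -/

section OFBM

variable {Ω : Type*} [MeasurableSpace Ω] {n : ℕ}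

/-- Equality of all finite-dimensional distributions of two processes indexed by `ℝ`. -/
def SameLaw (X Y : ℝ → Ω → (Fin n → ℝ)) (P : Measure Ω) : Prop :=
  ∀ I : Finset ℝ, IdentDistrib (fun ω => I.restrict (X · ω)) (fun ω => I.restrict (Y · ω)) P P

/-- The matrix power `c ^ H = exp (log c • H)`, for `c > 0`. -/
noncomputable def matrixRpow (c : ℝ) (H : Matrix (Fin n) (Fin n) ℝ) : Matrix (Fin n) (Fin n) ℝ :=
  NormedSpace.exp (Real.log c • H)

/-- The set of operator self-similarity exponents of `X`: the matrices `H` such that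
`{X (c t)} = {c ^ H X t}` in law for every `c > 0`. -/
def exponents (X : ℝ → Ω → (Fin n → ℝ)) (P : Measure Ω) : Set (Matrix (Fin n) (Fin n) ℝ) :=
  {H | ∀ c : ℝ, 0 < c →
    SameLaw (fun t ω => X (c * t) ω) (fun t ω => matrixRpow c H *ᵥ X t ω) P}

/-- The symmetry group `G₁` of `X`: the invertible matrices `A` with `{X t} = {A X t}` in law. -/
def symmetryGroup (X : ℝ → Ω → (Fin n → ℝ)) (P : Measure Ω) :
    Set (Matrix (Fin n) (Fin n) ℝ) :=
  {A | IsUnit A ∧ SameLaw X (fun t ω => A *ᵥ X t ω) P}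

/-- The process `{X (t + h) - X h}` has the same law for every shift `h`. -/
def HasStationaryIncrements (X : ℝ → Ω → (Fin n → ℝ)) (P : Measure Ω) : Prop :=
  ∀ h h' : ℝ, SameLaw (fun t ω => X (t + h) ω - X h ω) (fun t ω => X (t + h') ω - X h' ω) P

/-- For no `t ≠ 0` is the distribution of `X t` carried by a proper linear subspace of `ℝⁿ`.
(A process that scales as below, with an exponent whose characteristic roots have positive real
parts, vanishes almost surely at `t = 0`, so `t = 0` has to be left out.) -/
def IsProperProcess (X : ℝ → Ω → (Fin n → ℝ)) (P : Measure Ω) : Prop :=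
  ∀ t : ℝ, t ≠ 0 → ∀ V : Submodule ℝ (Fin n → ℝ), (∀ᵐ ω ∂P, X t ω ∈ V) → V = ⊤

/-- `X s` converges in law to `X t` as `s → t`, for every `t`. -/
def IsContinuousInLaw (X : ℝ → Ω → (Fin n → ℝ)) (P : Measure Ω) [IsProbabilityMeasure P] : Prop :=
  ∀ t : ℝ, TendstoInDistribution X (𝓝 t) (X t) (fun _ => P) P

/-- Operator fractional Brownian motion: a proper Gaussian process with stationary increments that
is operator self-similar, that is, continuous in law and scaling with some exponent. -/
structure IsOFBM (X : ℝ → Ω → (Fin n → ℝ)) (P : Measure Ω) [IsProbabilityMeasure P] : Prop where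
  gaussian : IsGaussianProcess X P
  proper : IsProperProcess X P
  continuous_in_law : IsContinuousInLaw X P
  stationary_increments : HasStationaryIncrements X P
  exists_exponent : (exponents X P).Nonempty

/-- `{X t} = {X (-t)}` in law. -/
def IsTimeReversible (X : ℝ → Ω → (Fin n → ℝ)) (P : Measure Ω) : Prop :=
  SameLaw X (fun t ω => X (-t) ω) P

end OFBM

/-- Two sets of matrices are conjugate: `G = W K W⁻¹` for some invertible matrix `W`. -/
def AreConjugate {n : ℕ} (G K : Set (Matrix (Fin n) (Fin n) ℝ)) : Prop :=
  ∃ W : GL (Fin n) ℝ,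
    G = (fun A => (W : Matrix (Fin n) (Fin n) ℝ) * A * (W⁻¹ : GL (Fin n) ℝ)) '' K

/-! The process is centred because `0 < h < 1`, so its law is encoded by Γ(s,t) = E[B(s) B(t)ᵀ], and
both properties become statements about Γ. Stationary increments and scaling make the symmetric part
of Γ(s,t) a scalar multiple of Γ(1,1). Everything therefore hinges on the antisymmetric part: each
side of the equivalence amounts to Γ(s,t) = Γ(t,s).

Under reversibility, the antisymmetric part is a biadditive cocycle
(`eq_four_mul_of_alternating_cocycle`). Doubling time multiplies it by 4, but also by 2^(2h) < 4, so
it vanishes. Then Γ(s,t) is a multiple of Γ(1,1) = W Wᵀ, whose stabiliser under V ↦ A V Aᵀ is W O(n)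
W⁻¹.

Conversely, if the group is W O(n) W⁻¹, then W⁻¹ Γ(s,t) W⁻ᵀ is fixed by O(n), hence symmetric
(`eq_transpose_of_forall_orthogonal`). -/

theorem matrixRpow_smul_one {n : ℕ} {c : ℝ} (hc : 0 < c) (h : ℝ) :
    matrixRpow c (h • (1 : Matrix (Fin n) (Fin n) ℝ)) = (c ^ h) • 1 := by
  rw [matrixRpow, smul_smul, smul_one_eq_diagonal, Matrix.exp_diagonal, smul_one_eq_diagonal]
  congr 1
  ext i
  rw [Pi.coe_exp, ← Real.exp_eq_exp_ℝ, Real.rpow_def_of_pos hc]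

/-! ### Second moments and the law of a centred Gaussian process -/

section Moments

variable {Ω : Type*} [MeasurableSpace Ω] {P : Measure Ω} {n : ℕ} {X Y : ℝ → Ω → (Fin n → ℝ)}

/-- The matrix of second moments `E[X s (X t)ᵀ]`. -/
noncomputable def crossMoment (X : ℝ → Ω → (Fin n → ℝ)) (P : Measure Ω) (s t : ℝ) :
    Matrix (Fin n) (Fin n) ℝ :=
  Matrix.of fun i j => ∫ ω, X s ω i * X t ω j ∂P

theorem crossMoment_apply (s t : ℝ) (i j : Fin n) :
    crossMoment X P s t i j = ∫ ω, X s ω i * X t ω j ∂P := rfl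

theorem crossMoment_transpose (s t : ℝ) : (crossMoment X P s t)ᵀ = crossMoment X P t s := by
  ext i j
  simp only [transpose_apply, crossMoment_apply, mul_comm]

theorem SameLaw.integral_apply_eq (hXY : SameLaw X Y P) (t : ℝ) (i : Fin n) :
    ∫ ω, X t ω i ∂P = ∫ ω, Y t ω i ∂P := by
  have hu : Measurable fun x : ({t} : Finset ℝ) → Fin n → ℝ => x ⟨t, by simp⟩ i := by fun_prop
  exact ((hXY {t}).comp hu).integral_eq

theorem SameLaw.crossMoment_eq (hXY : SameLaw X Y P) (s t : ℝ) :
    crossMoment X P s t = crossMoment Y P s t := by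
  ext i j
  have hu : Measurable fun x : ({s, t} : Finset ℝ) → Fin n → ℝ =>
      x ⟨s, by simp⟩ i * x ⟨t, by simp⟩ j := by fun_prop
  exact ((hXY {s, t}).comp hu).integral_eq

theorem memLp_apply (hX : IsGaussianProcess X P) (t : ℝ) (i : Fin n) :
    MemLp (fun ω => X t ω i) 2 P :=
  (hX.hasGaussianLaw_eval t).memLp_two.eval i

theorem integrable_apply (hX : IsGaussianProcess X P) (t : ℝ) (i : Fin n) :
    Integrable (fun ω => X t ω i) P :=
  (hX.hasGaussianLaw_eval t).integrable.eval i

theorem integrable_apply_mul_apply (hX : IsGaussianProcess X P) (s t : ℝ) (i j : Fin n) :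
    Integrable (fun ω => X s ω i * X t ω j) P :=
  (memLp_apply hX s i).integrable_mul (memLp_apply hX t j)

theorem isGaussianProcess_mulVec (hX : IsGaussianProcess X P) (A : Matrix (Fin n) (Fin n) ℝ) :
    IsGaussianProcess (fun t ω => A *ᵥ X t ω) P :=
  hX.comp_left fun _ => A.mulVecLin.toContinuousLinearMap

theorem integral_mulVec_apply (hX : IsGaussianProcess X P) (A : Matrix (Fin n) (Fin n) ℝ)
    (t : ℝ) (i : Fin n) :
    ∫ ω, (A *ᵥ X t ω) i ∂P = ∑ j, A i j * ∫ ω, X t ω j ∂P := by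
  simp only [mulVec, dotProduct]
  rw [integral_finsetSum _ fun j _ => (integrable_apply hX t j).const_mul _]
  simp only [integral_const_mul]

theorem crossMoment_mulVec (hX : IsGaussianProcess X P) (A : Matrix (Fin n) (Fin n) ℝ)
    (s t : ℝ) :
    crossMoment (fun t ω => A *ᵥ X t ω) P s t = A * crossMoment X P s t * Aᵀ := by
  ext i j
  simp only [crossMoment_apply, mulVec, dotProduct, Finset.sum_mul_sum, mul_apply, transpose_apply]
  have hint : ∀ k l, Integrable (fun ω => A i k * X s ω k * (A j l * X t ω l)) P := fun k l => by
    refine ((integrable_apply_mul_apply hX s t k l).const_mul (A i k * A j l)).congr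
      (ae_of_all _ fun ω => ?_)
    simp only
    ring
  rw [integral_finsetSum _ fun k _ => integrable_finsetSum _ fun l _ => hint k l]
  simp only [Finset.sum_mul]
  rw [Finset.sum_comm]
  refine Finset.sum_congr rfl fun k _ => ?_
  rw [integral_finsetSum _ fun l _ => hint k l]
  refine Finset.sum_congr rfl fun l _ => ?_
  rw [← integral_const_mul, ← integral_mul_const]
  congr 1 with ω
  ring

theorem strongDual_restrict_apply {I : Finset ℝ} (L : StrongDual ℝ (I → Fin n → ℝ))
    (x : I → Fin n → ℝ) :
    L x = ∑ p : I × Fin n, L (Pi.single p.1 (Pi.single p.2 1)) * x p.1 p.2 := by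
  have hx : x = ∑ p : I × Fin n, x p.1 p.2 • Pi.single p.1 (Pi.single p.2 (1 : ℝ)) := by
    ext t i
    simp only [Finset.sum_apply, Pi.smul_apply, smul_eq_mul, Fintype.sum_prod_type]
    rw [Finset.sum_eq_single t (fun s _ hs => by simp [Pi.single_eq_of_ne hs.symm]) (by simp)]
    simp [Pi.single_apply]
  conv_lhs => rw [hx, map_sum]
  exact Finset.sum_congr rfl fun p _ => by rw [map_smul, smul_eq_mul, mul_comm]

theorem integral_strongDual_restrict (hX : IsGaussianProcess X P)
    (hX0 : ∀ t i, ∫ ω, X t ω i ∂P = 0) (I : Finset ℝ) (L : StrongDual ℝ (I → Fin n → ℝ)) :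
    ∫ ω, L (I.restrict (X · ω)) ∂P = 0 := by
  simp_rw [fun ω => strongDual_restrict_apply L (I.restrict (X · ω)), Finset.restrict]
  rw [integral_finsetSum _ fun p _ => (integrable_apply hX _ _).const_mul _]
  simp [integral_const_mul, hX0]

/-- The characteristic function of a centred Gaussian vector involves only these variances, which
are thus expressed through second moments alone. -/
theorem variance_strongDual_restrict (hX : IsGaussianProcess X P)
    (hX0 : ∀ t i, ∫ ω, X t ω i ∂P = 0) (I : Finset ℝ) (L : StrongDual ℝ (I → Fin n → ℝ)) :
    Var[L ∘ fun ω => I.restrict (X · ω); P] =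
      ∑ p : I × Fin n, ∑ q : I × Fin n, L (Pi.single p.1 (Pi.single p.2 1)) *
        L (Pi.single q.1 (Pi.single q.2 1)) * crossMoment X P p.1 q.1 p.2 q.2 := by
  have hint : ∀ p q : I × Fin n, Integrable (fun ω =>
      L (Pi.single p.1 (Pi.single p.2 1)) * X p.1 ω p.2 *
        (L (Pi.single q.1 (Pi.single q.2 1)) * X q.1 ω q.2)) P := fun p q =>
    ((memLp_apply hX _ _).const_mul _).integrable_mul ((memLp_apply hX _ _).const_mul _)
  rw [variance_of_integral_eq_zero ((hX.hasGaussianLaw I).map L).aemeasurable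
    (integral_strongDual_restrict hX hX0 I L)]
  simp_rw [Function.comp_apply, fun ω => strongDual_restrict_apply L (I.restrict (X · ω)),
    Finset.restrict, sq, Finset.sum_mul_sum]
  rw [integral_finsetSum _ fun p _ => integrable_finsetSum _ fun q _ => hint p q]
  refine Finset.sum_congr rfl fun p _ => ?_
  rw [integral_finsetSum _ fun q _ => hint p q]
  refine Finset.sum_congr rfl fun q _ => ?_
  rw [crossMoment_apply, ← integral_const_mul]
  congr 1 with ω
  ring

/-- Centered Gaussian processes with the same second moments have the same law. -/
theorem sameLaw_of_crossMoment_eq (hX : IsGaussianProcess X P) (hY : IsGaussianProcess Y P)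
    (hX0 : ∀ t i, ∫ ω, X t ω i ∂P = 0) (hY0 : ∀ t i, ∫ ω, Y t ω i ∂P = 0)
    (hXY : ∀ s t, crossMoment X P s t = crossMoment Y P s t) : SameLaw X Y P := by
  intro I
  refine ⟨(hX.hasGaussianLaw I).aemeasurable, (hY.hasGaussianLaw I).aemeasurable, ?_⟩
  have := (hX.hasGaussianLaw I).isGaussian_map
  have := (hY.hasGaussianLaw I).isGaussian_map
  refine Measure.ext_of_charFunDual (funext fun L => ?_)
  rw [(hX.hasGaussianLaw I).charFunDual_map_eq, (hY.hasGaussianLaw I).charFunDual_map_eq,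
    variance_strongDual_restrict hX hX0, variance_strongDual_restrict hY hY0]
  simp only [Function.comp_apply, integral_strongDual_restrict hX hX0,
    integral_strongDual_restrict hY hY0, hXY]

end Moments

/-! ### Alternating cocycles on the line -/

/-- An antisymmetric 2-cocycle on `ℝ` is biadditive; in terms of homogeneous cochains, an
alternating function of two increments that is invariant under time reversal is quadratic under
doubling. -/
theorem eq_four_mul_of_alternating_cocycle {A : ℝ → ℝ → ℝ} (hanti : ∀ s t, A s t = -A t s)
    (hneg : ∀ s t, A (-s) (-t) = A s t)
    (hcoc : ∀ s t u, A (t + u) (s + u) - A (t + u) u - A u (s + u) = A t s) (s t : ℝ) :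
    A (2 * s) (2 * t) = 4 * A s t := by
  have hzero : ∀ t, A t 0 = 0 := fun t => by
    have := hcoc t t 0
    have h1 := hanti 0 0
    have h2 := hanti 0 t
    have h3 := hcoc 0 t 0
    simp only [add_zero] at this h3
    linarith
  -- Put f(a,b) = A a (a + b); the claim is f(b,a) = -f(a,b). Translations turn the two sides into
  -- -A (-b) a and -A b (-a), which time reversal identifies.
  have hskew : ∀ a b, A b (a + b) = -A a (a + b) := fun a b => by
    have h1 := hcoc (a + b) b (-b)
    have h2 := hcoc (-a) b a
    have h3 := hneg b (-a)
    have h4 := hanti (-b) 0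
    have h5 := hzero (-b)
    have h6 := hanti 0 a
    have h7 := hzero a
    have h8 := hzero (a + b)
    have h9 := hanti (a + b) a
    rw [neg_neg] at h3
    rw [add_neg_cancel, add_neg_cancel_right] at h1
    rw [neg_add_cancel, add_comm b a] at h2
    linarith
  -- The inhomogeneous 2-cocycle identity for f.
  have hc : ∀ a b d, A (a + b) (a + b + d) + A a (a + b) = A a (a + (b + d)) + A b (b + d) :=
    fun a b d => by
      have h1 := hcoc (b + d) b a
      have h2 := hanti (a + b) a
      rw [add_comm b a, show b + d + a = a + (b + d) by ring] at h1
      rw [add_assoc]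
      linarith
  have hadd : ∀ a b d, A a (a + (b + d)) = A a (a + b) + A a (a + d) := fun a b d => by
    have h1 := hc a b d
    have h2 := hc b a d
    have h3 := hc b d a
    have h4 := hskew a b
    have h5 := hskew a d
    have h6 := hskew a (b + d)
    rw [add_comm b a] at h2
    rw [add_comm d a, show b + d + a = a + (b + d) by ring] at h3
    linarith
  -- Skewness gives f(a,a) = 0, so A itself equals f and inherits its additivity.
  have hlin : ∀ a s, A a s = A a (a + s) := fun a s => by
    have h1 := hadd a (s - a) a
    have h2 := hskew a a
    rw [sub_add_cancel, add_sub_cancel] at h1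
    linarith
  have hright : ∀ a s, A a (2 * s) = 2 * A a s := fun a s => by
    rw [two_mul, hlin a (s + s), hadd, ← hlin, two_mul]
  rw [hright, hanti, hright, hanti s t]
  ring

/-! ### Covariance structure for a scalar exponent -/

section FBM

variable {Ω : Type*} [MeasurableSpace Ω] {P : Measure Ω} {n : ℕ} {B : ℝ → Ω → (Fin n → ℝ)} {h : ℝ}

theorem integral_apply_mul_of_exponent (hB : IsGaussianProcess B P)
    (hexp : h • (1 : Matrix (Fin n) (Fin n) ℝ) ∈ exponents B P) {c : ℝ} (hc : 0 < c) (t : ℝ)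
    (i : Fin n) : ∫ ω, B (c * t) ω i ∂P = c ^ h * ∫ ω, B t ω i ∂P := by
  rw [(hexp c hc).integral_apply_eq t i, integral_mulVec_apply hB, matrixRpow_smul_one hc]
  simp [Matrix.one_apply]

theorem crossMoment_mul_of_exponent (hB : IsGaussianProcess B P)
    (hexp : h • (1 : Matrix (Fin n) (Fin n) ℝ) ∈ exponents B P) {c : ℝ} (hc : 0 < c) (s t : ℝ) :
    crossMoment B P (c * s) (c * t) = c ^ (2 * h) • crossMoment B P s t := by
  change crossMoment (fun t ω => B (c * t) ω) P s t = _
  rw [(hexp c hc).crossMoment_eq s t, crossMoment_mulVec hB, matrixRpow_smul_one hc, two_mul,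
    Real.rpow_add hc]
  simp [smul_smul]

/-- Scaling by 2 first kills the mean at 0. Stationary increments then double the mean from t to 2t,
whereas scaling multiplies it by 2^h < 2. -/
theorem integral_apply_eq_zero_of_exponent (hB : IsGaussianProcess B P)
    (hstat : HasStationaryIncrements B P) (h0 : 0 < h) (h1 : h < 1)
    (hexp : h • (1 : Matrix (Fin n) (Fin n) ℝ) ∈ exponents B P) (t : ℝ) (i : Fin n) :
    ∫ ω, B t ω i ∂P = 0 := by
  have h2 : (1 : ℝ) < 2 ^ h := Real.one_lt_rpow one_lt_two h0
  have h3 : (2 : ℝ) ^ h < 2 := by simpa using Real.rpow_lt_rpow_of_exponent_lt one_lt_two h1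
  have hz := integral_apply_mul_of_exponent hB hexp two_pos 0 i
  have ht := integral_apply_mul_of_exponent hB hexp two_pos t i
  have hs := (hstat t 0).integral_apply_eq t i
  simp only [Pi.sub_apply, add_zero] at hs
  rw [integral_sub (integrable_apply hB _ i) (integrable_apply hB _ i),
    integral_sub (integrable_apply hB _ i) (integrable_apply hB _ i), ← two_mul, ht] at hs
  rw [mul_zero] at hz
  have hz0 : ∫ ω, B 0 ω i ∂P = 0 := by
    have : (2 ^ h - 1) * ∫ ω, B 0 ω i ∂P = 0 := by linarith
    exact (mul_eq_zero.1 this).resolve_left (by linarith)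
  have : (2 ^ h - 2) * ∫ ω, B t ω i ∂P = 0 := by linarith
  exact (mul_eq_zero.1 this).resolve_left (by linarith)

/-- Time 0 is fixed by scaling, so E[B(0)ᵢ²] = 0 and B(0) vanishes almost surely. -/
theorem crossMoment_zero_left (hB : IsGaussianProcess B P) (h0 : 0 < h)
    (hexp : h • (1 : Matrix (Fin n) (Fin n) ℝ) ∈ exponents B P) (t : ℝ) :
    crossMoment B P 0 t = 0 := by
  ext i j
  have h2 : (1 : ℝ) < 2 ^ (2 * h) := Real.one_lt_rpow one_lt_two (by positivity)
  have hz := congrFun₂ (crossMoment_mul_of_exponent hB hexp two_pos 0 0) i i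
  simp only [mul_zero, Matrix.smul_apply, smul_eq_mul] at hz
  have hz0 : crossMoment B P 0 0 i i = 0 := by
    have : (2 ^ (2 * h) - 1) * crossMoment B P 0 0 i i = 0 := by linarith
    exact (mul_eq_zero.1 this).resolve_left (by linarith)
  have hae := (integral_eq_zero_iff_of_nonneg (fun ω => mul_self_nonneg (B 0 ω i))
    (integrable_apply_mul_apply hB 0 0 i i)).1 hz0
  rw [crossMoment_apply, Matrix.zero_apply]
  refine integral_eq_zero_of_ae ?_
  filter_upwards [hae] with ω hω
  simp [mul_self_eq_zero.1 hω]

theorem crossMoment_zero_right (hB : IsGaussianProcess B P) (h0 : 0 < h)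
    (hexp : h • (1 : Matrix (Fin n) (Fin n) ℝ) ∈ exponents B P) (t : ℝ) :
    crossMoment B P t 0 = 0 := by
  rw [← crossMoment_transpose, crossMoment_zero_left hB h0 hexp, transpose_zero]

theorem crossMoment_sub (hB : IsGaussianProcess B P) (u s t : ℝ) :
    crossMoment (fun t ω => B (t + u) ω - B u ω) P s t =
      crossMoment B P (s + u) (t + u) - crossMoment B P (s + u) u - crossMoment B P u (t + u) +
        crossMoment B P u u := by
  ext i j
  have hint := fun a b => integrable_apply_mul_apply hB a b i j
  simp only [Matrix.add_apply, Matrix.sub_apply, crossMoment_apply, Pi.sub_apply]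
  have hexpand : (fun ω => (B (s + u) ω i - B u ω i) * (B (t + u) ω j - B u ω j)) = fun ω =>
      B (s + u) ω i * B (t + u) ω j - B (s + u) ω i * B u ω j - B u ω i * B (t + u) ω j +
        B u ω i * B u ω j := by
    ext ω
    ring
  rw [hexpand, integral_add, integral_sub, integral_sub]
  · exact hint _ _
  · exact hint _ _
  · exact (hint _ _).sub (hint _ _)
  · exact hint _ _
  · exact ((hint _ _).sub (hint _ _)).sub (hint _ _)
  · exact hint _ _

theorem crossMoment_add (hB : IsGaussianProcess B P) (hstat : HasStationaryIncrements B P)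
    (h0 : 0 < h) (hexp : h • (1 : Matrix (Fin n) (Fin n) ℝ) ∈ exponents B P) (s t u : ℝ) :
    crossMoment B P (s + u) (t + u) - crossMoment B P (s + u) u - crossMoment B P u (t + u) +
        crossMoment B P u u = crossMoment B P s t := by
  rw [← crossMoment_sub hB, (hstat u 0).crossMoment_eq, crossMoment_sub hB]
  simp [crossMoment_zero_left hB h0 hexp, crossMoment_zero_right hB h0 hexp]

theorem crossMoment_self (hB : IsGaussianProcess B P) (hstat : HasStationaryIncrements B P)
    (h0 : 0 < h) (hexp : h • (1 : Matrix (Fin n) (Fin n) ℝ) ∈ exponents B P) (t : ℝ) :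
    crossMoment B P t t = |t| ^ (2 * h) • crossMoment B P 1 1 := by
  have hpos : ∀ t, 0 < t → crossMoment B P t t = |t| ^ (2 * h) • crossMoment B P 1 1 :=
    fun t ht => by
      rw [abs_of_pos ht]
      simpa using crossMoment_mul_of_exponent hB hexp ht 1 1
  rcases lt_trichotomy t 0 with ht | rfl | ht
  -- The shift by -t sends t to 0 and leaves only the moment at -t > 0.
  · have h1 := crossMoment_add hB hstat h0 hexp t t (-t)
    rw [add_neg_cancel, crossMoment_zero_left hB h0 hexp, crossMoment_zero_left hB h0 hexp,
      crossMoment_zero_right hB h0 hexp] at h1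
    rw [← h1, hpos (-t) (by linarith), abs_neg]
    simp
  · rw [crossMoment_zero_left hB h0 hexp, abs_zero, Real.zero_rpow (by positivity), zero_smul]
  · exact hpos t ht

/-- The symmetrised second moments are those of a scalar fractional Brownian motion times the
covariance matrix at time `1`. -/
theorem crossMoment_add_swap (hB : IsGaussianProcess B P) (hstat : HasStationaryIncrements B P)
    (h0 : 0 < h) (hexp : h • (1 : Matrix (Fin n) (Fin n) ℝ) ∈ exponents B P) (s t : ℝ) :
    crossMoment B P s t + crossMoment B P t s =
      (|s| ^ (2 * h) + |t| ^ (2 * h) - |s - t| ^ (2 * h)) • crossMoment B P 1 1 := by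
  have h1 := crossMoment_add hB hstat h0 hexp (s - t) (s - t) t
  rw [sub_add_cancel, crossMoment_self hB hstat h0 hexp s, crossMoment_self hB hstat h0 hexp t,
    crossMoment_self hB hstat h0 hexp (s - t)] at h1
  rw [sub_smul, add_smul, ← h1]
  abel

theorem crossMoment_eq_smul_of_swap (hB : IsGaussianProcess B P)
    (hstat : HasStationaryIncrements B P) (h0 : 0 < h)
    (hexp : h • (1 : Matrix (Fin n) (Fin n) ℝ) ∈ exponents B P)
    (hswap : ∀ s t, crossMoment B P s t = crossMoment B P t s) (s t : ℝ) :
    crossMoment B P s t =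
      ((|s| ^ (2 * h) + |t| ^ (2 * h) - |s - t| ^ (2 * h)) / 2) • crossMoment B P 1 1 := by
  have h1 := crossMoment_add_swap hB hstat h0 hexp s t
  rw [← hswap s t, ← two_smul ℝ] at h1
  rw [div_eq_inv_mul, mul_smul, ← h1, smul_smul]
  norm_num

theorem crossMoment_swap_of_reversible (hB : IsGaussianProcess B P)
    (hstat : HasStationaryIncrements B P) (h0 : 0 < h) (h1 : h < 1)
    (hexp : h • (1 : Matrix (Fin n) (Fin n) ℝ) ∈ exponents B P) (hrev : IsTimeReversible B P)
    (s t : ℝ) : crossMoment B P s t = crossMoment B P t s := by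
  ext i j
  have hneg : ∀ s t, crossMoment B P (-s) (-t) = crossMoment B P s t := fun s t =>
    (hrev.crossMoment_eq s t).symm
  -- In the difference of the two increment identities, the term at (u, u) cancels.
  have hquad := eq_four_mul_of_alternating_cocycle
    (A := fun s t => crossMoment B P s t i j - crossMoment B P t s i j)
    (fun s t => by ring) (fun s t => by simp only [hneg]) (fun s t u => by
      have e1 := congrFun₂ (crossMoment_add hB hstat h0 hexp t s u) i j
      have e2 := congrFun₂ (crossMoment_add hB hstat h0 hexp s t u) i j
      simp only [Matrix.add_apply, Matrix.sub_apply] at e1 e2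
      linarith) s t
  simp only [crossMoment_mul_of_exponent hB hexp two_pos, Matrix.smul_apply, smul_eq_mul] at hquad
  have h2 : (2 : ℝ) ^ (2 * h) < 4 := by
    have := Real.rpow_lt_rpow_of_exponent_lt one_lt_two (show 2 * h < 2 by linarith)
    norm_num at this
    exact this
  have : (2 ^ (2 * h) - 4) * (crossMoment B P s t i j - crossMoment B P t s i j) = 0 := by
    linarith
  exact sub_eq_zero.1 ((mul_eq_zero.1 this).resolve_left (by linarith))

/-- Symmetry forces the scalar fractional Brownian covariance, which is invariant under (s,t) ↦
(-s,-t). -/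
theorem isTimeReversible_of_swap (hB : IsGaussianProcess B P)
    (hstat : HasStationaryIncrements B P) (h0 : 0 < h) (h1 : h < 1)
    (hexp : h • (1 : Matrix (Fin n) (Fin n) ℝ) ∈ exponents B P)
    (hswap : ∀ s t, crossMoment B P s t = crossMoment B P t s) : IsTimeReversible B P := by
  have hmean := integral_apply_eq_zero_of_exponent hB hstat h0 h1 hexp
  refine sameLaw_of_crossMoment_eq hB (hB.comp_right fun t => -t) hmean
    (fun t => hmean (-t)) fun s t => ?_
  change _ = crossMoment B P (-s) (-t)
  rw [crossMoment_eq_smul_of_swap hB hstat h0 hexp hswap,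
    crossMoment_eq_smul_of_swap hB hstat h0 hexp hswap (-s), abs_neg, abs_neg, neg_sub_neg,
    abs_sub_comm]

theorem mem_symmetryGroup_iff (hB : IsGaussianProcess B P) (hstat : HasStationaryIncrements B P)
    (h0 : 0 < h) (h1 : h < 1) (hexp : h • (1 : Matrix (Fin n) (Fin n) ℝ) ∈ exponents B P)
    (A : Matrix (Fin n) (Fin n) ℝ) :
    A ∈ symmetryGroup B P ↔
      IsUnit A ∧ ∀ s t, A * crossMoment B P s t * Aᵀ = crossMoment B P s t := by
  have hmean := integral_apply_eq_zero_of_exponent hB hstat h0 h1 hexp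
  refine and_congr_right fun _ => ⟨fun hA s t => ?_, fun hA => ?_⟩
  · rw [← crossMoment_mulVec hB]
    exact (hA.crossMoment_eq s t).symm
  · refine sameLaw_of_crossMoment_eq hB (isGaussianProcess_mulVec hB A) hmean (fun t i => ?_)
      fun s t => ?_
    · simp [integral_mulVec_apply hB, hmean]
    · rw [crossMoment_mulVec hB, hA]

/-- If E[(x · B(t))²] = 0, then B(t) lies almost surely in the hyperplane orthogonal to x;
properness forces x · x = 0. -/
theorem posDef_crossMoment (hB : IsGaussianProcess B P) (hproper : IsProperProcess B P) {t : ℝ}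
    (ht : t ≠ 0) : (crossMoment B P t t).PosDef := by
  have hquad : ∀ x : Fin n → ℝ, x ⬝ᵥ crossMoment B P t t *ᵥ x = ∫ ω, (x ⬝ᵥ B t ω) ^ 2 ∂P :=
    fun x => by
      have hint : ∀ i j, Integrable (fun ω => x i * B t ω i * (x j * B t ω j)) P := fun i j =>
        ((memLp_apply hB t i).const_mul _).integrable_mul ((memLp_apply hB t j).const_mul _)
      simp only [dotProduct, mulVec, sq, Finset.sum_mul_sum]
      simp only [Finset.mul_sum]
      rw [integral_finsetSum _ fun i _ => integrable_finsetSum _ fun j _ => hint i j]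
      refine Finset.sum_congr rfl fun i _ => ?_
      rw [integral_finsetSum _ fun j _ => hint i j]
      refine Finset.sum_congr rfl fun j _ => ?_
      rw [crossMoment_apply, ← integral_mul_const, ← integral_const_mul]
      congr 1 with ω
      ring
  refine .of_dotProduct_mulVec_pos ?_ fun x hx => ?_
  · rw [IsHermitian, conjTranspose_eq_transpose_of_trivial, crossMoment_transpose]
  · rw [star_trivial, hquad]
    refine lt_of_le_of_ne (integral_nonneg fun ω => sq_nonneg _) fun hzero => hx ?_
    have hint : Integrable (fun ω => (x ⬝ᵥ B t ω) ^ 2) P := by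
      refine MemLp.integrable_sq ?_
      simp only [dotProduct]
      exact memLp_finsetSum _ fun i _ => (memLp_apply hB t i).const_mul _
    have hae := (integral_eq_zero_iff_of_nonneg (fun ω => sq_nonneg (x ⬝ᵥ B t ω)) hint).1 hzero.symm
    have htop := hproper t ht (LinearMap.ker (dotProductBilin ℝ ℝ x)) (by
      filter_upwards [hae] with ω hω
      simpa using hω)
    have hxx : x ∈ LinearMap.ker (dotProductBilin ℝ ℝ x) := htop ▸ Submodule.mem_top
    simpa using hxx

end FBM

/-! ### Stabilisers of quadratic forms and conjugates of O(n) -/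

section Conjugation

variable {n : ℕ}

open scoped MatrixOrder in
theorem Matrix.PosDef.exists_mul_transpose {V : Matrix (Fin n) (Fin n) ℝ} (hV : V.PosDef) :
    ∃ W : GL (Fin n) ℝ, V = (W : Matrix (Fin n) (Fin n) ℝ) * (W : Matrix (Fin n) (Fin n) ℝ)ᵀ := by
  obtain ⟨C, hC⟩ := CStarAlgebra.nonneg_iff_eq_star_mul_self.mp hV.posSemidef.nonneg
  have hCu : IsUnit (star C) := by
    have := hV.isUnit
    rw [hC] at this
    exact isUnit_of_mul_isUnit_left this
  refine ⟨hCu.unit, ?_⟩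
  rw [hC]
  simp [star_eq_conjTranspose]

theorem mem_conj_orthogonalGroup_iff (W : GL (Fin n) ℝ) (A : Matrix (Fin n) (Fin n) ℝ) :
    A ∈ (fun A => (W : Matrix (Fin n) (Fin n) ℝ) * A * (W⁻¹ : GL (Fin n) ℝ)) ''
        (Matrix.orthogonalGroup (Fin n) ℝ : Set (Matrix (Fin n) (Fin n) ℝ)) ↔
      A * (W * (W : Matrix (Fin n) (Fin n) ℝ)ᵀ) * Aᵀ = W * (W : Matrix (Fin n) (Fin n) ℝ)ᵀ := by
  set w : Matrix (Fin n) (Fin n) ℝ := (W : Matrix (Fin n) (Fin n) ℝ)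
  set v : Matrix (Fin n) (Fin n) ℝ := ((W⁻¹ : GL (Fin n) ℝ) : Matrix (Fin n) (Fin n) ℝ)
  have hwv : w * v = 1 := W.mul_inv
  have hvw : v * w = 1 := W.inv_mul
  have hwvT : wᵀ * vᵀ = 1 := by rw [← transpose_mul, hvw, transpose_one]
  constructor
  · rintro ⟨O, hO, rfl⟩
    have hO' : O * Oᵀ = 1 := (mem_orthogonalGroup_iff _ _).1 hO
    calc w * O * v * (w * wᵀ) * (w * O * v)ᵀ = w * O * (v * w) * (wᵀ * vᵀ) * Oᵀ * wᵀ := by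
          simp only [transpose_mul, Matrix.mul_assoc]
      _ = w * (O * Oᵀ) * wᵀ := by
          rw [hvw, hwvT]
          simp only [Matrix.mul_assoc, Matrix.one_mul]
      _ = w * wᵀ := by rw [hO', Matrix.mul_one]
  · intro hA
    refine ⟨v * A * w, (mem_orthogonalGroup_iff _ _).2 ?_, ?_⟩
    · calc v * A * w * (v * A * w)ᵀ = v * (A * (w * wᵀ) * Aᵀ) * vᵀ := by
            simp only [transpose_mul, Matrix.mul_assoc]
        _ = (v * w) * (wᵀ * vᵀ) := by
            rw [hA]
            simp only [Matrix.mul_assoc]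
        _ = 1 := by rw [hvw, hwvT, Matrix.one_mul]
    · calc w * (v * A * w) * v = (w * v) * A * (w * v) := by simp only [Matrix.mul_assoc]
        _ = A := by rw [hwv, Matrix.one_mul, Matrix.mul_one]

/-- Coordinate reflections suffice: flipping the sign of coordinate i negates N i j for j ≠ i, so N
is diagonal. -/
theorem eq_transpose_of_forall_orthogonal {N : Matrix (Fin n) (Fin n) ℝ}
    (hN : ∀ O ∈ Matrix.orthogonalGroup (Fin n) ℝ, O * N * Oᵀ = N) : Nᵀ = N := by
  ext i j
  rcases eq_or_ne i j with rfl | hij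
  · rfl
  have hoff : ∀ i j, i ≠ j → N i j = 0 := fun i j hij => by
    have hO : diagonal (Function.update (1 : Fin n → ℝ) i (-1)) ∈
        Matrix.orthogonalGroup (Fin n) ℝ := by
      rw [mem_orthogonalGroup_iff, diagonal_transpose, diagonal_mul_diagonal, ← diagonal_one]
      congr 1
      ext k
      rcases eq_or_ne k i with rfl | hk
      · simp
      · simp [hk]
    have h1 := congrFun₂ (hN _ hO) i j
    rw [diagonal_transpose, mul_diagonal, diagonal_mul, Function.update_self,
      Function.update_of_ne hij.symm] at h1
    simp only [Pi.one_apply] at h1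
    linarith
  rw [transpose_apply, hoff i j hij, hoff j i hij.symm]

end Conjugation

/-! ### The equivalence -/

theorem proposition5p3 {Ω : Type*} [MeasurableSpace Ω] (P : Measure Ω) [IsProbabilityMeasure P]
    (n : ℕ) (B : ℝ → Ω → (Fin n → ℝ)) (hB : IsOFBM B P)
    (h : ℝ) (h0 : 0 < h) (h1 : h < 1)
    (hexp : h • (1 : Matrix (Fin n) (Fin n) ℝ) ∈ exponents B P) :
    IsTimeReversible B P ↔
      AreConjugate (symmetryGroup B P)
        (Matrix.orthogonalGroup (Fin n) ℝ : Set (Matrix (Fin n) (Fin n) ℝ)) := by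
  have hG := hB.gaussian
  have hS := hB.stationary_increments
  have hmem := mem_symmetryGroup_iff hG hS h0 h1 hexp
  constructor
  · intro hrev
    have hV := posDef_crossMoment hG hB.proper one_ne_zero
    obtain ⟨W, hW⟩ := hV.exists_mul_transpose
    have hmul := crossMoment_eq_smul_of_swap hG hS h0 hexp
      (crossMoment_swap_of_reversible hG hS h0 h1 hexp hrev)
    refine ⟨W, Set.ext fun A => ?_⟩
    rw [hmem, mem_conj_orthogonalGroup_iff, ← hW]
    refine ⟨fun hA => hA.2 1 1, fun hA => ⟨?_, fun s t => ?_⟩⟩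
    -- Invertibility of A comes for free from A V Aᵀ = V with V invertible.
    · have hu := hV.isUnit
      rw [← hA, Matrix.mul_assoc] at hu
      exact isUnit_of_mul_isUnit_left hu
    · rw [hmul, Matrix.mul_smul, Matrix.smul_mul, hA]
  · rintro ⟨W, hW⟩
    refine isTimeReversible_of_swap hG hS h0 h1 hexp fun s t => ?_
    set w : Matrix (Fin n) (Fin n) ℝ := (W : Matrix (Fin n) (Fin n) ℝ)
    set v : Matrix (Fin n) (Fin n) ℝ := ((W⁻¹ : GL (Fin n) ℝ) : Matrix (Fin n) (Fin n) ℝ)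
    have hwv : w * v = 1 := W.mul_inv
    have hvw : v * w = 1 := W.inv_mul
    have hvwT : vᵀ * wᵀ = 1 := by rw [← transpose_mul, hwv, transpose_one]
    have hwvT : wᵀ * vᵀ = 1 := by rw [← transpose_mul, hvw, transpose_one]
    have hN := eq_transpose_of_forall_orthogonal (N := v * crossMoment B P s t * vᵀ) fun O hO => by
      have hA : w * O * v ∈ symmetryGroup B P := hW ▸ ⟨O, hO, rfl⟩
      have hfix := ((hmem _).1 hA).2 s t
      rw [transpose_mul, transpose_mul] at hfix
      calc O * (v * crossMoment B P s t * vᵀ) * Oᵀ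
          = (v * w) * O * v * crossMoment B P s t * vᵀ * Oᵀ * (wᵀ * vᵀ) := by
            rw [hvw, hwvT]; simp only [Matrix.mul_assoc, Matrix.one_mul, Matrix.mul_one]
        _ = v * (w * O * v * crossMoment B P s t * (vᵀ * (Oᵀ * wᵀ))) * vᵀ := by
            simp only [Matrix.mul_assoc]
        _ = _ := by rw [hfix]
    rw [transpose_mul, transpose_mul, transpose_transpose, crossMoment_transpose] at hN
    calc crossMoment B P s t = (w * v) * crossMoment B P s t * (vᵀ * wᵀ) := by
          rw [hwv, hvwT, Matrix.one_mul, Matrix.mul_one]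
      _ = w * (v * crossMoment B P s t * vᵀ) * wᵀ := by simp only [Matrix.mul_assoc]
      _ = (w * v) * crossMoment B P t s * (vᵀ * wᵀ) := by rw [← hN]; simp only [Matrix.mul_assoc]
      _ = crossMoment B P t s := by rw [hwv, hvwT, Matrix.one_mul, Matrix.mul_one]
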